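/- Let $n\ge 1$. The Miura-ori $M_{2,n}$ is a $2\times n$ array of congruent non-rectangular parallelograms, the faces $\alpha_{i,j}$ ($i=1,2$, $1\le j\le n$), in which parallel horizontal lines are crossed by zig-zags that bend at the line between the two rows. It has $n-1$ interior vertices, all on that line, and its creases are the $3n-2$ edges that are not on the boundary of the paper. At each interior vertex four creases meet (one to the left, one to the right, one above and one below), and the sector angles, counterclockwise from the right crease, are $\theta,\ \pi-\theta,\ \pi-\theta,\ \theta$, where $0<\theta<\pi/2$ is the acute angle of the parallelograms. A mountain-valley assignment of $M_{2,n}$ is a function $\mu$ from the creases to $\{-1,1\}$ ($1$ for a mountain, $-1$ for a valley). It is locally valid if, at each interior vertex, the four faces around that vertex can be folded flat without self-intersection with the mountains and valleys that $\mu$ prescribes. A face flip of a face $\alpha$ replaces $\mu(e)$ by $-\mu(e)$ for every crease $e$ that borders $\alpha$ and leaves all other values of $\mu$ unchanged. The origami flip graph $\mathrm{OFG}(M_{2,n})$ is the graph whose vertices are the locally valid mountain-valley assignments of $M_{2,n}$, two of them being adjacent if and only if they differ by one face flip. **Theorem.** For every $n\ge 1$, the diameter of $\mathrm{OFG}(M_{2,n})$,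 that is, the maximum over all pairs of vertices of the length of a shortest path between them, is $\left\lceil \frac{n^2}{2}\right\rceil$. (In particular, the graph is connected.) -/

import Mathlib

/-!
The `2 × n` Miura-ori, flat foldings of its vertices, and its origami flip graph.
-/

namespace Origami

section SingleVertex

/-! ### Flat foldings of a degree-four vertex

The creases at the vertex are numbered `0, 1, 2, 3` counterclockwise. Sector `i` lies between
crease `i` and crease `i + 1`, so crease `i` separates the sectors `i - 1` and `i` (indices are
taken modulo `4`); `ρ i` is the angle of sector `i`. -/

/-- Angular position of crease `i` once all four creases are folded, with crease `0` at `0`: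
the direction of travel along a small circle around the vertex reverses at each crease. -/
def foldedPos (ρ : Fin 4 → ℝ) : Fin 4 → ℝ :=
  ![0, ρ 0, ρ 0 - ρ 1, ρ 0 - ρ 1 + ρ 2]

/-- In the stacking order `L`, the sector `c` lies strictly between the sectors `a` and `b`. -/
def LayerBetween (L : Equiv.Perm (Fin 4)) (a b c : Fin 4) : Prop :=
  (L a < L c ∧ L c < L b) ∨ (L b < L c ∧ L c < L a)

/-- `L` is the bottom-to-top stacking order of the four sectors in a flat folding, without
self-intersection, of the vertex with sector angles `ρ`, whose crease `i` is a mountain if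
`m i = 1` and a valley if `m i = -1`. In the folded state the sectors `0` and `2` keep the upper
side of the paper up, and the sectors `1` and `3` are turned over. -/
structure IsFlatFolding (ρ : Fin 4 → ℝ) (m : Fin 4 → ℤˣ) (L : Equiv.Perm (Fin 4)) : Prop where
  /-- The folded sectors close up around the vertex. -/
  closes : ρ 0 - ρ 1 + ρ 2 - ρ 3 = 0
  /-- A crease is a valley exactly if, of the two sectors that it joins, the one that is turned
  over lies above the one that is not. -/
  valley_iff : ∀ i : Fin 4, m i = -1 ↔
    if Even (i : ℕ) then L i < L (i - 1) else L (i - 1) < L i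
  /-- No sector passes through a crease: a sector that extends to both sides of the folded crease
  `i` does not lie between the two sectors joined there. -/
  not_through : ∀ i k : Fin 4,
    min (foldedPos ρ k) (foldedPos ρ (k + 1)) < foldedPos ρ i →
    foldedPos ρ i < max (foldedPos ρ k) (foldedPos ρ (k + 1)) →
    ¬ LayerBetween L (i - 1) i k
  /-- Two creases that are folded to the same place, with their sectors on the same side of it,
  do not cross: the two pairs of sectors are nested or disjoint in the stacking order. -/
  not_crossing : ∀ i k : Fin 4, i ≠ k → (Even (i : ℕ) ↔ Even (k : ℕ)) →
    foldedPos ρ i = foldedPos ρ k →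
    (LayerBetween L (i - 1) i (k - 1) ↔ LayerBetween L (i - 1) i k)

/-- The vertex with sector angles `ρ` folds flat with the mountains and valleys `m`. -/
def FoldsFlat (ρ : Fin 4 → ℝ) (m : Fin 4 → ℤˣ) : Prop :=
  ∃ L : Equiv.Perm (Fin 4), IsFlatFolding ρ m L

end SingleVertex

section Miura

/-! ### The crease pattern `M_{2,n}`

Columns are numbered `0, …, n - 1` from left to right; row `0` is the upper and row `1` the lower
row of parallelograms. The interior vertices `0, …, n - 2` lie in a single row, vertex `k` between
the columns `k` and `k + 1`. -/

/-- The `3 n - 2` creases of `M_{2,n}` (the boundary of the paper is not creased). -/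
inductive MiuraCrease (n : ℕ) : Type
  /-- the horizontal crease between the two faces of column `j` -/
  | mid (j : Fin n)
  /-- the slanted crease above the vertex `k` -/
  | above (k : Fin (n - 1))
  /-- the slanted crease below the vertex `k` -/
  | below (k : Fin (n - 1))

/-- The parallelograms of `M_{2,n}`, indexed by row and column. -/
abbrev MiuraFace (n : ℕ) : Type := Fin 2 × Fin n

/-- The crease borders the face. -/
def Borders {n : ℕ} : MiuraCrease n → MiuraFace n → Prop
  | .mid j, f => f.2 = j
  | .above k, f => f.1 = 0 ∧ ((f.2 : ℕ) = k ∨ (f.2 : ℕ) = k + 1)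
  | .below k, f => f.1 = 1 ∧ ((f.2 : ℕ) = k ∨ (f.2 : ℕ) = k + 1)

/-- The four creases at the vertex `k`, counterclockwise: right, above, left, below. -/
def creasesAt {n : ℕ} (k : Fin (n - 1)) : Fin 4 → MiuraCrease n :=
  ![.mid ⟨k + 1, by omega⟩, .above k, .mid ⟨k, by omega⟩, .below k]

/-- The sector angles at each interior vertex, counterclockwise from the right crease, where `θ`
is the acute angle of the parallelograms. Both slanted creases at the vertex lean to the right, so
the two acute angles meet at the right crease and the two obtuse angles at the left crease. -/
noncomputable def miuraAngles (θ : ℝ) : Fin 4 → ℝ :=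
  ![θ, Real.pi - θ, Real.pi - θ, θ]

/-- Mountain-valley assignments of `M_{2,n}`; `1` is mountain and `-1` is valley. -/
abbrev MVAssignment (n : ℕ) : Type := MiuraCrease n → ℤˣ

/-- Each interior vertex folds flat with its mountains and valleys. -/
def LocallyValid {n : ℕ} (θ : ℝ) (μ : MVAssignment n) : Prop :=
  ∀ k : Fin (n - 1), FoldsFlat (miuraAngles θ) (fun i => μ (creasesAt k i))

open Classical in
/-- The face flip: swap mountain and valley on each crease that borders the face `f`. -/
noncomputable def faceFlip {n : ℕ} (μ : MVAssignment n) (f : MiuraFace n) : MVAssignment n :=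
  fun c => if Borders c f then -μ c else μ c

theorem faceFlip_faceFlip {n : ℕ} (μ : MVAssignment n) (f : MiuraFace n) :
    faceFlip (faceFlip μ f) f = μ := by
  funext c
  by_cases h : Borders c f <;> simp [faceFlip, h]

theorem faceFlip_ne {n : ℕ} (μ : MVAssignment n) (f : MiuraFace n) : faceFlip μ f ≠ μ := by
  intro h
  have h1 := congrFun h (.mid f.2)
  have hb : Borders (.mid f.2 : MiuraCrease n) f := rfl
  simp only [faceFlip, if_pos hb] at h1
  exact units_ne_neg_self _ h1.symm

/-- The origami flip graph `OFG(M_{2,n})`: the vertices are the locally valid mountain-valley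
assignments, and two of them are adjacent if and only if they differ by one face flip. -/
def miuraFlipGraph (n : ℕ) (θ : ℝ) :
    SimpleGraph {μ : MVAssignment n // LocallyValid θ μ} where
  Adj μ ν := ∃ f : MiuraFace n, (ν : MVAssignment n) = faceFlip (μ : MVAssignment n) f
  symm := by
    constructor
    rintro μ ν ⟨f, hf⟩
    exact ⟨f, by rw [hf, faceFlip_faceFlip]⟩
  loopless := by
    constructor
    rintro μ ⟨f, hf⟩
    exact faceFlip_ne _ f hf.symm

end Miura

end Origami

/-!
A mountain-valley assignment of `M_{2,n}` is locally valid exactly if it is `Balanced`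
(`locallyValid_iff_balanced`), and this says that it is the discrete gradient of a height function
on the faces (`IsHeight`), with steps `±1` between neighbours. The height function is unique up to an
additive constant. A face flip between locally valid assignments changes the height by `2` at one
face; conversely, of two height functions of the same parity, one can always be moved towards the
other by flipping a lowest face at which it is below. Hence the distance between two assignments
with height functions `h` and `g` is the minimum over integers `c` of `∑ |d - c|`, where `d` is half
of `g - h`, a function that changes by at most `1` between neighbouring faces.

For the upper bound, let `c` be a median of `d`. Since every value strictly between two values of
`d` occurs in both rows (`IsSlow.two_le_card_level`), the `p` values above `c` contribute at most
`(p + 1) ^ 2 / 4` (`sum_toNat_le`), likewise the `q` values below, and `p, q ≤ n`,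
`p + q ≤ 2 n - 2` give `⌈n ^ 2 / 2⌉` (`IsSlow.exists_sum_abs_le`).

For the lower bound, the height functions `i + j` and `-(i + j)` on row `i` and column `j` differ by
`2 (i + j)`; pairing opposite faces shows that `∑ |i + j - c| ≥ n ^ 2 / 2` for every `c`
(`exists_le_edist`).
-/

namespace Origami

open Finset

/-! ### Signs of a flat-folding Miura vertex -/

/-- For the angles `θ, π - θ, π - θ, θ` with `θ < π / 2`, the folded creases `1` and `3` coincide at
`θ`, and crease `0` lies strictly between them and crease `2`. So the only obstructions left are
that the two obtuse sectors must not pass through crease `0`, and that creases `1` and `3` must not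
cross: a finite condition that no longer mentions `θ`. -/
theorem foldsFlat_iff_stack {θ : ℝ} (hθ₀ : 0 < θ) (hθ₁ : θ < Real.pi / 2) (m : Fin 4 → ℤˣ) :
    FoldsFlat (miuraAngles θ) m ↔ ∃ L : Equiv.Perm (Fin 4),
      ((m 0 = -1 ↔ L 0 < L 3) ∧ (m 1 = -1 ↔ L 0 < L 1) ∧
        (m 2 = -1 ↔ L 2 < L 1) ∧ (m 3 = -1 ↔ L 2 < L 3)) ∧
      (¬ LayerBetween L 3 0 1 ∧ ¬ LayerBetween L 3 0 2) ∧
      (LayerBetween L 0 1 2 ↔ LayerBetween L 0 1 3) ∧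
      (LayerBetween L 2 3 0 ↔ LayerBetween L 2 3 1) := by
  have p0 : foldedPos (miuraAngles θ) 0 = 0 := rfl
  have p1 : foldedPos (miuraAngles θ) 1 = θ := rfl
  have p2 : foldedPos (miuraAngles θ) 2 = 2 * θ - Real.pi := by
    simp [foldedPos, miuraAngles]; ring
  have p3 : foldedPos (miuraAngles θ) 3 = θ := by simp [foldedPos, miuraAngles]
  have e01 : (0 : Fin 4) - 1 = 3 := rfl
  have e11 : (1 : Fin 4) - 1 = 0 := rfl
  have e21 : (2 : Fin 4) - 1 = 1 := rfl
  have e31 : (3 : Fin 4) - 1 = 2 := rfl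
  have a0 : (0 : Fin 4) + 1 = 1 := rfl
  have a1 : (1 : Fin 4) + 1 = 2 := rfl
  have a2 : (2 : Fin 4) + 1 = 3 := rfl
  have a3 : (3 : Fin 4) + 1 = 0 := rfl
  have v3 : ((3 : Fin 4) : ℕ) = 3 := rfl
  have o3 : ¬ Even 3 := by decide
  refine exists_congr fun L => ⟨fun h => ?_, fun ⟨hv, ht, hc⟩ => ⟨?_, ?_, ?_, ?_⟩⟩
  · refine ⟨?_, ⟨?_, ?_⟩, ?_, ?_⟩
    · have := h.valley_iff
      simpa [Fin.forall_fin_succ, e01, e11, e21, e31, v3, o3] using this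
    · refine h.not_through 0 1 ?_ ?_
      · rw [a1, p1, p2, p0]; exact min_lt_of_right_lt (by linarith)
      · rw [a1, p1, p2, p0]; exact lt_max_of_lt_left hθ₀
    · refine h.not_through 0 2 ?_ ?_
      · rw [a2, p2, p3, p0]; exact min_lt_of_left_lt (by linarith)
      · rw [a2, p2, p3, p0]; exact lt_max_of_lt_right hθ₀
    · exact h.not_crossing 1 3 (by decide) (by decide) (p1.trans p3.symm) |>.symm
        |> fun h' => by simpa [e11, e31, iff_comm] using h'
    · exact h.not_crossing 3 1 (by decide) (by decide) (p3.trans p1.symm)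
  · simp [miuraAngles]
  · simpa [Fin.forall_fin_succ, e01, e11, e21, e31, v3, o3] using hv
  -- Only crease `0` lies strictly inside the folded state, so only it can be passed through.
  · have hle (k : Fin 4) : foldedPos (miuraAngles θ) k ≤ θ := by
      fin_cases k <;> simp [p0, p1, p2, p3] <;> linarith
    have hge (k : Fin 4) : 2 * θ - Real.pi ≤ foldedPos (miuraAngles θ) k := by
      fin_cases k <;> simp [p0, p1, p2, p3] <;> linarith
    intro i k h₁ h₂
    fin_cases i
    · fin_cases k
      · simp [a0, p0, p1, hθ₀.le] at h₁
      · exact ht.1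
      · exact ht.2
      · simp [a3, p0, p3, hθ₀.le] at h₁
    · exact absurd (p1 ▸ h₂) (max_le (hle _) (hle _)).not_gt
    · exact absurd (p2 ▸ h₁) (le_min (hge _) (hge _)).not_gt
    · exact absurd (p3 ▸ h₂) (max_le (hle _) (hle _)).not_gt
  · intro i k hik hpar hpos
    fin_cases i <;> fin_cases k <;>
      simp_all <;> linarith

instance decidableLayerBetween (L : Equiv.Perm (Fin 4)) (a b c : Fin 4) :
    Decidable (LayerBetween L a b c) := by
  unfold LayerBetween; infer_instance

set_option synthInstance.maxSize 4000 in
set_option synthInstance.maxHeartbeats 400000 in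
set_option maxRecDepth 100000 in
/-- A stacking order exists exactly if, of the right, upper and lower creases `a`, `b`, `d`, two
agree with the left crease `c` and one does not: a check of the `24` stacking orders for each of
the `16` assignments. -/
theorem exists_stack_iff : ∀ a b c d : ℤˣ, (∃ L : Equiv.Perm (Fin 4),
      ((a = -1 ↔ L 0 < L 3) ∧ (b = -1 ↔ L 0 < L 1) ∧
        (c = -1 ↔ L 2 < L 1) ∧ (d = -1 ↔ L 2 < L 3)) ∧
      (¬ LayerBetween L 3 0 1 ∧ ¬ LayerBetween L 3 0 2) ∧
      (LayerBetween L 0 1 2 ↔ LayerBetween L 0 1 3) ∧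
      (LayerBetween L 2 3 0 ↔ LayerBetween L 2 3 1)) ↔ (a : ℤ) + b + d = c := by
  decide

/-! ### Height functions -/

/-- The first of the two faces at a crease. Together with `target` this orients the edges of the
dual `2 × n` grid: downwards, to the right in the upper row, and to the left in the lower row. With this
choice the signs around a vertex cancel exactly for locally valid assignments. -/
def source {n : ℕ} : MiuraCrease n → MiuraFace n
  | .mid j => (0, j)
  | .above k => (0, ⟨k, by omega⟩)
  | .below k => (1, ⟨k + 1, by omega⟩)

/-- The second of the two faces at a crease; see `source`. -/
def target {n : ℕ} : MiuraCrease n → MiuraFace n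
  | .mid j => (1, j)
  | .above k => (0, ⟨k + 1, by omega⟩)
  | .below k => (1, ⟨k, by omega⟩)

theorem source_ne_target {n : ℕ} (c : MiuraCrease n) : source c ≠ target c := by
  cases c <;> simp [source, target]

theorem borders_iff {n : ℕ} (c : MiuraCrease n) (f : MiuraFace n) :
    Borders c f ↔ f = source c ∨ f = target c := by
  obtain ⟨i, j⟩ := f
  cases c <;> fin_cases i <;> simp [Borders, source, target, Prod.ext_iff, Fin.ext_iff, or_comm]

/-- `h` is a height function of `μ`: across each crease, from `source` to `target`, the height drops
by the value `±1` of `μ` there. -/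
def IsHeight {n : ℕ} (h : MiuraFace n → ℤ) (μ : MVAssignment n) : Prop :=
  ∀ c, h (source c) - h (target c) = μ c

theorem coe_unit_eq (u : ℤˣ) : (u : ℤ) = 1 ∨ (u : ℤ) = -1 := by
  rcases Int.units_eq_one_or u with rfl | rfl <;> simp

/-- At each interior vertex the right, upper and lower creases sum to the left one. This is local
validity in terms of the signs alone, see `locallyValid_iff_balanced`; it says equally that the
drops of a height function around the vertex add up to zero. -/
def Balanced {n : ℕ} (μ : MVAssignment n) : Prop :=
  ∀ k : Fin (n - 1), (μ (.mid ⟨k + 1, by omega⟩) : ℤ) + μ (.above k) + μ (.below k)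
    = μ (.mid ⟨k, by omega⟩)

theorem IsHeight.balanced {n : ℕ} {h : MiuraFace n → ℤ} {μ : MVAssignment n}
    (hh : IsHeight h μ) : Balanced μ := by
  intro k
  rw [← hh, ← hh, ← hh, ← hh]
  simp only [source, target]
  ring

/-- The values of `h` follow a fixed checkerboard parity. Height functions are determined up to a
constant; this normalization makes any two of them differ by even values. -/
def IsParity {n : ℕ} (h : MiuraFace n → ℤ) : Prop :=
  ∀ f : MiuraFace n, Even (h f + (f.1 : ℕ) + (f.2 : ℕ) + 1)

theorem Balanced.exists_height {n : ℕ} {μ : MVAssignment n} (hμ : Balanced μ) :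
    ∃ h, IsHeight h μ ∧ IsParity h := by
  -- `s j` is the height of the lower face of column `j`. The value `1` beyond the last column is
  -- there only to make the parity of `s j` hold for all `j`.
  let s : ℕ → ℤ := fun j => ∑ i ∈ Finset.range j,
    if hi : i < n - 1 then (μ (.below ⟨i, hi⟩) : ℤ) else 1
  have hs (k : Fin (n - 1)) : s (k + 1) = s k + μ (.below k) := by
    simp [s, Finset.sum_range_succ]
  have hpar (j : ℕ) : Even (s j + j) := by
    induction j with
    | zero => simp [s]
    | succ j ih =>
      have h1 : s (j + 1) = s j + if hi : j < n - 1 then (μ (.below ⟨j, hi⟩) : ℤ) else 1 :=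
        Finset.sum_range_succ _ _
      rw [h1]
      split_ifs with hi
      · rcases coe_unit_eq (μ (.below ⟨j, hi⟩)) with h | h <;> rw [h] <;> push_cast <;> grind
      · push_cast; grind
  refine ⟨fun f => s f.2 + if f.1 = 0 then (μ (.mid f.2) : ℤ) else 0, ?_, ?_⟩
  · rintro (j | k | k)
    · simp [source, target]
    · have h1 := hμ k
      have h2 := hs k
      simp only [source, target, if_true]
      linarith
    · have h2 := hs k
      simp [source, target, h2]
  · rintro ⟨i, j⟩
    have h1 := hpar j
    fin_cases i
    · rcases coe_unit_eq (μ (.mid j)) with h | h <;> simp [h] <;> grind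
    · simp; grind

open Classical in
/-- At a strict local minimum of a height function, raising the height by `2` is a face flip. -/
theorem IsHeight.raise {n : ℕ} {h : MiuraFace n → ℤ} {μ : MVAssignment n} (hh : IsHeight h μ)
    {f : MiuraFace n} (h1 : ∀ c, source c = f → h (target c) = h f + 1)
    (h2 : ∀ c, target c = f → h (source c) = h f + 1) :
    IsHeight (Function.update h f (h f + 2)) (faceFlip μ f) := by
  intro c
  have hc := hh c
  have hne := source_ne_target c
  by_cases hs : source c = f
  · have ht : target c ≠ f := fun h => hne (hs.trans h.symm)
    have := h1 c hs
    rw [faceFlip, if_pos ((borders_iff c f).2 (Or.inl hs.symm)), Function.update_of_ne ht,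
      hs, Function.update_self, Units.val_neg, ← hc, hs]
    linarith
  · rw [Function.update_of_ne hs]
    by_cases ht : target c = f
    · have := h2 c ht
      rw [faceFlip, if_pos ((borders_iff c f).2 (Or.inr ht.symm)), ht, Function.update_self,
        Units.val_neg, ← hc, ht]
      linarith
    · rw [Function.update_of_ne ht, faceFlip, if_neg, hc]
      rw [borders_iff]
      exact fun h => h.elim (fun h => hs h.symm) (fun h => ht h.symm)

/-- A face flip that preserves local validity changes a height function at a single face, by `2`:
validity before and after forces all neighbours of the flipped face to have the same height. -/
theorem IsHeight.exists_faceFlip {n : ℕ} {h : MiuraFace n → ℤ} {μ : MVAssignment n}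
    (hh : IsHeight h μ) {f : MiuraFace n} (hf : Balanced (faceFlip μ f)) :
    ∃ h', IsHeight h' (faceFlip μ f) ∧ ∑ x, |h x - h' x| ≤ 2 := by
  classical
  obtain ⟨i, j⟩ := f
  have hx := coe_unit_eq (μ (.mid j))
  -- The new height is the reflection of the old one in the height of the other face of the column.
  refine ⟨Function.update h (i, j) (h (i, j) +
    if i = 0 then -2 * (μ (.mid j) : ℤ) else 2 * (μ (.mid j) : ℤ)), ?_, ?_⟩
  · rintro (j' | k | k)
    · have := hh (.mid j')
      by_cases hj : j' = j
      · subst hj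
        fin_cases i <;>
          simp [source, target, faceFlip, Borders] at this ⊢ <;> linarith
      · have hj' : ¬ j = j' := fun h => hj h.symm
        simpa [source, target, faceFlip, Borders, Function.update_apply, hj, hj'] using this
    · have h1 := hh (.above k)
      have h2 := hh.balanced k
      have h3 := hf k
      fin_cases i
      · by_cases e1 : (j : ℕ) = k
        · obtain rfl : j = ⟨k, k.2.trans_le (Nat.sub_le n 1)⟩ := Fin.ext e1
          simp [source, target, faceFlip, Borders] at h1 h2 h3 ⊢
          linarith
        · by_cases e2 : (j : ℕ) = k + 1
          · obtain rfl : j = ⟨k + 1, Nat.add_lt_of_lt_sub k.2⟩ := Fin.ext e2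
            simp [source, target, faceFlip, Borders] at h1 h2 h3 ⊢
            linarith
          · have e1' : ¬ (k : ℕ) = j := fun h => e1 h.symm
            have e2' : ¬ (k + 1 : ℕ) = j := fun h => e2 h.symm
            simpa [source, target, faceFlip, Borders, Function.update_apply, Fin.ext_iff,
              e1, e2, e1', e2'] using h1
      · simpa [source, target, faceFlip, Borders, Function.update_apply] using h1
    · have h1 := hh (.below k)
      have h2 := hh.balanced k
      have h3 := hf k
      fin_cases i
      · simpa [source, target, faceFlip, Borders, Function.update_apply] using h1
      · by_cases e1 : (j : ℕ) = k
        · obtain rfl : j = ⟨k, k.2.trans_le (Nat.sub_le n 1)⟩ := Fin.ext e1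
          simp [source, target, faceFlip, Borders] at h1 h2 h3 ⊢
          linarith
        · by_cases e2 : (j : ℕ) = k + 1
          · obtain rfl : j = ⟨k + 1, Nat.add_lt_of_lt_sub k.2⟩ := Fin.ext e2
            simp [source, target, faceFlip, Borders] at h1 h2 h3 ⊢
            linarith
          · have e1' : ¬ (k : ℕ) = j := fun h => e1 h.symm
            have e2' : ¬ (k + 1 : ℕ) = j := fun h => e2 h.symm
            simpa [source, target, faceFlip, Borders, Function.update_apply, Fin.ext_iff,
              e1, e2, e1', e2'] using h1
  · rw [Finset.sum_eq_single (i, j) (fun x _ hx => by rw [Function.update_of_ne hx]; simp)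
      (by simp), Function.update_self]
    split_ifs <;> rcases hx with h | h <;> rw [h] <;> norm_num

/-- Local validity depends only on the signs at each vertex, and not on `θ`. -/
theorem locallyValid_iff_balanced {n : ℕ} {θ : ℝ} (hθ₀ : 0 < θ) (hθ₁ : θ < Real.pi / 2)
    {μ : MVAssignment n} : LocallyValid θ μ ↔ Balanced μ :=
  forall_congr' fun k => by
    rw [foldsFlat_iff_stack hθ₀ hθ₁, exists_stack_iff]
    rfl

/-! ### Slowly varying functions on the grid of faces -/

/-- Discrete intermediate value theorem. -/
theorem exists_eq_of_step {a : ℕ → ℤ} {v : ℤ} {i j : ℕ} (hij : i ≤ j)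
    (ha : ∀ k, i ≤ k → k < j → |a (k + 1) - a k| ≤ 1)
    (h : a i ≤ v ∧ v ≤ a j ∨ a j ≤ v ∧ v ≤ a i) : ∃ k, i ≤ k ∧ k ≤ j ∧ a k = v := by
  induction j, hij using Nat.le_induction with
  | base => exact ⟨i, le_rfl, le_rfl, by omega⟩
  | succ j hij ih =>
    by_cases hv : a (j + 1) = v
    · exact ⟨j + 1, by omega, le_rfl, hv⟩
    · have h1 := abs_le.1 (ha j hij (by omega))
      obtain ⟨k, h2, h3, h4⟩ := ih (fun k h2 h3 => ha k h2 (by omega)) (by omega)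
      exact ⟨k, h2, by omega, h4⟩

/-- `d` changes by at most `1` between neighbouring faces. -/
def IsSlow {n : ℕ} (d : MiuraFace n → ℤ) : Prop :=
  (∀ j, |d (1, j) - d (0, j)| ≤ 1) ∧
    ∀ i (k : ℕ) (hk : k + 1 < n), |d (i, ⟨k + 1, hk⟩) - d (i, ⟨k, by omega⟩)| ≤ 1

theorem isSlow_of_crease {n : ℕ} {d : MiuraFace n → ℤ}
    (hd : ∀ c, |d (source c) - d (target c)| ≤ 1) : IsSlow d := by
  refine ⟨fun j => ?_, fun i k hk => ?_⟩
  · rw [abs_sub_comm]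
    exact hd (.mid j)
  · have hk' : k < n - 1 := by omega
    fin_cases i
    · rw [abs_sub_comm]
      exact hd (.above ⟨k, hk'⟩)
    · exact hd (.below ⟨k, hk'⟩)

theorem IsSlow.exists_row_eq {n : ℕ} {d : MiuraFace n → ℤ} (hd : IsSlow d) {v : ℤ} (i : Fin 2)
    {j₁ j₂ : Fin n} (h₁ : d (i, j₁) ≤ v) (h₂ : v ≤ d (i, j₂)) : ∃ j, d (i, j) = v := by
  let a : ℕ → ℤ := fun k => if hk : k < n then d (i, ⟨k, hk⟩) else 0
  have ha (j : Fin n) : a j = d (i, j) := by simp [a]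
  have step (k : ℕ) (hk : k + 1 < n) : |a (k + 1) - a k| ≤ 1 := by
    have := hd.2 i k hk
    simpa [a, hk, show k < n by omega] using this
  obtain ⟨k, hk, hkv⟩ : ∃ k, k < n ∧ a k = v := by
    rcases le_total (j₁ : ℕ) j₂ with h | h
    · obtain ⟨k, -, h2, h3⟩ := exists_eq_of_step (a := a) (v := v) h
        (fun k _ h2 => step k (by omega)) (Or.inl ⟨by rwa [ha], by rwa [ha]⟩)
      exact ⟨k, by omega, h3⟩
    · obtain ⟨k, -, h2, h3⟩ := exists_eq_of_step (a := a) (v := v) h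
        (fun k _ h2 => step k (by omega)) (Or.inr ⟨by rwa [ha], by rwa [ha]⟩)
      exact ⟨k, by omega, h3⟩
  exact ⟨⟨k, hk⟩, by rw [← hkv, ← ha]⟩

/-- Every value strictly between two values of `d` is attained in both rows, because a column in
which `d` exceeds `v` somewhere is nowhere below `v`, and vice versa. -/
theorem IsSlow.two_le_card_level {n : ℕ} {d : MiuraFace n → ℤ} (hd : IsSlow d) {v : ℤ}
    {x y : MiuraFace n} (hx : d x < v) (hy : v < d y) : 2 ≤ #{f | d f = v} := by
  obtain ⟨i, j⟩ := x
  obtain ⟨i', j'⟩ := y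
  have key (r : Fin 2) : ∃ k, d (r, k) = v := by
    have h1 := abs_le.1 (hd.1 j)
    have h2 := abs_le.1 (hd.1 j')
    refine hd.exists_row_eq r (j₁ := j) (j₂ := j') ?_ ?_
    · fin_cases r <;> fin_cases i <;> simp at hx ⊢ <;> omega
    · fin_cases r <;> fin_cases i' <;> simp at hy ⊢ <;> omega
  obtain ⟨k₀, h₀⟩ := key 0
  obtain ⟨k₁, h₁⟩ := key 1
  have : 1 < #{f | d f = v} :=
    one_lt_card.2 ⟨(0, k₀), by simpa using h₀, (1, k₁), by simpa using h₁, by simp⟩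
  exact this

/-- If every positive level below the maximum is attained at least twice, then the sum of the
positive part is largest when the `p` positive values are `1, 1, 2, 2, 3, 3, …`, up to one top value attained
once. That sum is `(p + 1) ^ 2 / 4`, rounded down. -/
theorem sum_toNat_le {α : Type*} [Fintype α] (M : ℕ) (d : α → ℤ) (hM : ∀ x, d x ≤ M)
    (hd : ∀ t : ℤ, 0 < t → (∃ x, t < d x) → 2 ≤ #{x | d x = t}) :
    4 * ∑ x, (d x).toNat ≤ (#{x | 0 < d x} + 1) ^ 2 := by
  induction M generalizing d with
  | zero =>
    have : ∑ x, (d x).toNat = 0 := sum_eq_zero fun x _ => by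
      have := hM x
      push_cast at this; omega
    omega
  | succ M ih =>
    -- Lowering all values by `1` removes one unit for each of the `p` positive values.
    have hsum : ∑ x, (d x).toNat = #{x | 0 < d x} + ∑ x, (d x - 1).toNat := by
      rw [card_filter, ← sum_add_distrib]
      exact sum_congr rfl fun x _ => by split_ifs <;> omega
    have ih' := ih (fun x => d x - 1) (fun x => by have := hM x; push_cast at this; omega)
      (fun t ht ⟨x, hx⟩ => by
        have := hd (t + 1) (by omega) ⟨x, by omega⟩
        simpa [sub_eq_iff_eq_add] using this)
    by_cases hx : ∃ x, 1 < d x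
    · have h2 := hd 1 one_pos hx
      have hcard : #{x | 0 < d x} = #{x | 0 < d x - 1} + #{x | d x = 1} := by
        simp only [card_filter, ← sum_add_distrib]
        exact sum_congr rfl fun x _ => by split_ifs <;> omega
      rw [hsum, hcard] at *
      nlinarith
    · have h0 : ∑ x, (d x - 1).toNat = 0 := sum_eq_zero fun x _ => by
        by_contra h
        exact hx ⟨x, by omega⟩
      rw [hsum, h0]
      nlinarith [sq_nonneg ((#{x | 0 < d x} : ℤ) - 1)]

/-- An integer median: at most half of the values lie above `c` and at most half below. -/
theorem exists_median {α : Type*} [Fintype α] [Nonempty α] (d : α → ℤ) :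
    ∃ c, 2 * #{x | c < d x} ≤ Fintype.card α ∧ 2 * #{x | d x < c} ≤ Fintype.card α := by
  obtain ⟨a, ha⟩ := Finite.exists_min d
  obtain ⟨b, hb⟩ := Finite.exists_max d
  obtain ⟨c, hc, hmin⟩ := Int.exists_least_of_bdd
    (P := fun c => 2 * #{x | c < d x} ≤ Fintype.card α)
    ⟨d a, fun c hc => by
      by_contra! h
      rw [filter_true_of_mem (fun x _ => h.trans_le (ha x)), card_univ] at hc
      have := Fintype.card_pos (α := α)
      omega⟩
    ⟨d b, by
      rw [filter_false_of_mem (fun x _ => not_lt.2 (hb x))]; simp⟩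
  refine ⟨c, hc, ?_⟩
  have h1 : ¬ 2 * #{x | c - 1 < d x} ≤ Fintype.card α := fun h => by
    have := hmin _ h
    omega
  have h2 : #{x | c - 1 < d x} + #{x | d x < c} = Fintype.card α := by
    rw [← card_univ, card_filter, card_filter, card_eq_sum_ones, ← sum_add_distrib]
    exact sum_congr rfl fun x _ => by split_ifs <;> omega
  omega

/-- With `p` values above and `q` below a median `c`, the sum is at most
`((p + 1) ^ 2 + (q + 1) ^ 2) / 4`. Here `p, q ≤ n`, and the value `c` itself is attained twice
when `p` and `q` are positive, so that `p + q ≤ 2 * n - 2`. -/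
theorem IsSlow.exists_sum_abs_le {n : ℕ} (hn : 1 ≤ n) {d : MiuraFace n → ℤ} (hd : IsSlow d) :
    ∃ c, 2 * ∑ x, |d x - c| ≤ n ^ 2 + 1 := by
  have : Nonempty (MiuraFace n) := ⟨(0, ⟨0, hn⟩)⟩
  obtain ⟨c, hp, hq⟩ := exists_median d
  have hcard : Fintype.card (MiuraFace n) = 2 * n := by simp
  rw [hcard] at hp hq
  refine ⟨c, ?_⟩
  have hsum : ∑ x, |d x - c| = ((∑ x, (d x - c).toNat + ∑ x, (c - d x).toNat : ℕ) : ℤ) := by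
    rw [← sum_add_distrib, Nat.cast_sum]
    refine sum_congr rfl fun x _ => ?_
    rcases abs_cases (d x - c) with h | h <;> push_cast <;> omega
  have htri : #{x | c < d x} + #{x | d x = c} + #{x | d x < c} = 2 * n := by
    rw [← hcard, ← card_univ, card_filter, card_filter, card_filter, card_eq_sum_ones,
      ← sum_add_distrib, ← sum_add_distrib]
    exact sum_congr rfl fun x _ => by split_ifs <;> omega
  obtain ⟨b, hb⟩ := Finite.exists_max d
  obtain ⟨a, ha⟩ := Finite.exists_min d
  have hP : 4 * ∑ x, (d x - c).toNat ≤ (#{x | c < d x} + 1) ^ 2 := by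
    have := sum_toNat_le (d b - c).toNat (fun x => d x - c)
      (fun x => by have := hb x; omega) fun t ht ⟨x, hx⟩ => by
        obtain ⟨y, hy⟩ : ∃ y, d y ≤ c := by
          by_contra! h
          rw [filter_true_of_mem (fun x _ => h x), card_univ, hcard] at hp
          omega
        have := hd.two_le_card_level (v := c + t) (x := y) (y := x) (by omega) (by omega)
        simpa [sub_eq_iff_eq_add, add_comm] using this
    simpa using this
  have hQ : 4 * ∑ x, (c - d x).toNat ≤ (#{x | d x < c} + 1) ^ 2 := by
    have := sum_toNat_le (c - d a).toNat (fun x => c - d x)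
      (fun x => by have := ha x; omega) fun t ht ⟨x, hx⟩ => by
        obtain ⟨y, hy⟩ : ∃ y, c ≤ d y := by
          by_contra! h
          rw [filter_true_of_mem (fun x _ => h x), card_univ, hcard] at hq
          omega
        have := hd.two_le_card_level (v := c - t) (x := x) (y := y) (by omega) (by omega)
        refine this.trans_eq (congrArg card (filter_congr fun x _ => ?_))
        omega
    simpa using this
  have hlevel : #{x | c < d x} = 0 ∨ #{x | d x < c} = 0 ∨ 2 ≤ #{x | d x = c} := by
    by_contra! h
    obtain ⟨x, hx⟩ := card_pos.1 (Nat.pos_of_ne_zero h.1)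
    obtain ⟨y, hy⟩ := card_pos.1 (Nat.pos_of_ne_zero h.2.1)
    have := hd.two_le_card_level (v := c) (x := y) (y := x) (by simpa using hy) (by simpa using hx)
    omega
  rw [hsum]
  generalize ∑ x, (d x - c).toNat = P at *
  generalize ∑ x, (c - d x).toNat = Q at *
  generalize #{x | c < d x} = p at *
  generalize #{x | d x < c} = q at *
  generalize #{x | d x = c} = r at *
  zify at hn hp hq hP hQ htri ⊢
  have hp' : (p : ℤ) ≤ n := by omega
  have hq' : (q : ℤ) ≤ n := by omega
  rcases hlevel with rfl | rfl | h
  · have : P = 0 := by push_cast at hP; omega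
    subst this
    push_cast
    nlinarith [sq_nonneg ((n : ℤ) - 1)]
  · have : Q = 0 := by push_cast at hQ; omega
    subst this
    push_cast
    nlinarith [sq_nonneg ((n : ℤ) - 1)]
  · have h2 : (p : ℤ) + q ≤ 2 * n - 2 := by omega
    rcases hp'.lt_or_eq with h3 | h3
    · rcases hq'.lt_or_eq with h4 | h4
      · have : (p + 1 : ℤ) ^ 2 ≤ n ^ 2 := by gcongr; omega
        have : (q + 1 : ℤ) ^ 2 ≤ n ^ 2 := by gcongr; omega
        linarith
      · have : (p + 1 : ℤ) ^ 2 ≤ (n - 1) ^ 2 := by gcongr; omega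
        rw [h4] at hQ
        nlinarith
    · have : (q + 1 : ℤ) ^ 2 ≤ (n - 1) ^ 2 := by gcongr; omega
      rw [h3] at hP
      nlinarith

/-! ### Upper bound for the distance -/

theorem IsHeight.add_const {n : ℕ} {h : MiuraFace n → ℤ} {μ : MVAssignment n}
    (hh : IsHeight h μ) (c : ℤ) : IsHeight (fun f => h f + c) μ := fun x => by
  rw [← hh x]; ring

/-- If `h` is somewhere below `g`, some face flip moves `h` towards `g`: among the faces where
`h < g`, one of least height `h` is a strict local minimum of `h`. -/
theorem IsHeight.exists_raise {n : ℕ} {g h : MiuraFace n → ℤ} {μ ν : MVAssignment n}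
    (hh : IsHeight h μ) (hg : IsHeight g ν) (hpar : ∀ f, Even (g f - h f)) (hlt : ∃ f, h f < g f) :
    ∃ f h', IsHeight h' (faceFlip μ f) ∧ (∀ x, Even (g x - h' x)) ∧
      ∑ x, |g x - h' x| + 2 = ∑ x, |g x - h x| := by
  classical
  obtain ⟨f, hf, hmin⟩ := (univ.filter fun f => h f < g f).exists_min_image h
    (by obtain ⟨f, hf⟩ := hlt; exact ⟨f, by simpa using hf⟩)
  simp only [mem_filter, mem_univ, true_and] at hf hmin
  have key (x : MiuraFace n) (hx : h x = h f + 1 ∨ h x = h f - 1)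
      (hgx : g x = g f + 1 ∨ g x = g f - 1) : h x = h f + 1 := by
    -- A lower neighbour `x` would satisfy `g x ≤ h x`, which parity makes too far below `g f`.
    by_contra hne
    have h1 := hmin x
    have h2 := hpar f
    grind
  have h1 := hpar f
  refine ⟨f, _, hh.raise (f := f) (fun c hc => ?_) (fun c hc => ?_), fun x => ?_, ?_⟩
  · have h2 := hh c
    have h3 := hg c
    rw [hc] at h2 h3
    apply key
    · rcases coe_unit_eq (μ c) with h | h <;> omega
    · rcases coe_unit_eq (ν c) with h | h <;> omega
  · have h2 := hh c
    have h3 := hg c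
    rw [hc] at h2 h3
    apply key
    · rcases coe_unit_eq (μ c) with h | h <;> omega
    · rcases coe_unit_eq (ν c) with h | h <;> omega
  · rw [Function.update_apply]
    split_ifs with hx
    · subst hx; grind
    · exact hpar x
  · rw [← add_sum_erase univ _ (mem_univ f),
      ← add_sum_erase univ (fun x => |g x - h x|) (mem_univ f),
      sum_congr rfl fun x hx => by rw [Function.update_of_ne (ne_of_mem_erase hx)],
      Function.update_self, abs_of_nonneg (by grind), abs_of_nonneg (by omega)]
    ring

/-- The distance is at most half the `ℓ¹` distance of any two height functions of the same parity.
As the distance is symmetric, it is enough to raise whichever of the two is somewhere lower. -/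
theorem edist_le_of_heights {n : ℕ} {θ : ℝ} (hθ₀ : 0 < θ) (hθ₁ : θ < Real.pi / 2) (m : ℕ)
    (μ ν : {μ : MVAssignment n // LocallyValid θ μ}) {h g : MiuraFace n → ℤ}
    (hh : IsHeight h μ.1) (hg : IsHeight g ν.1) (hpar : ∀ f, Even (g f - h f))
    (hm : ∑ x, |g x - h x| ≤ 2 * m) : (miuraFlipGraph n θ).edist μ ν ≤ m := by
  induction m generalizing μ ν h g with
  | zero =>
    have h0 : ∀ x, g x = h x := by
      intro x
      have := (sum_eq_zero_iff_of_nonneg (fun x _ => abs_nonneg (g x - h x))).1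
        (le_antisymm (by simpa using hm) (sum_nonneg fun x _ => abs_nonneg _)) x (mem_univ x)
      rwa [abs_eq_zero, sub_eq_zero] at this
    have : μ = ν := Subtype.ext <| funext fun c => Units.ext <| by
      rw [← hh c, ← hg c, h0, h0]
    subst this
    simp
  | succ m ih =>
    have step (μ ν : {μ : MVAssignment n // LocallyValid θ μ}) {h g : MiuraFace n → ℤ}
        (hh : IsHeight h μ.1) (hg : IsHeight g ν.1) (hpar : ∀ f, Even (g f - h f))
        (hm : ∑ x, |g x - h x| ≤ 2 * (m + 1 : ℕ)) (hlt : ∃ f, h f < g f) :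
        (miuraFlipGraph n θ).edist μ ν ≤ (m + 1 : ℕ) := by
      obtain ⟨f, h', hh', hpar', hsum⟩ := hh.exists_raise hg hpar hlt
      let μ' : {μ : MVAssignment n // LocallyValid θ μ} :=
        ⟨faceFlip μ.1 f, (locallyValid_iff_balanced hθ₀ hθ₁).2 hh'.balanced⟩
      have hadj : (miuraFlipGraph n θ).Adj μ μ' := ⟨f, rfl⟩
      have h1 := ih μ' ν hh' hg hpar' (by push_cast at hm; linarith)
      calc (miuraFlipGraph n θ).edist μ ν
          ≤ (miuraFlipGraph n θ).edist μ μ' + (miuraFlipGraph n θ).edist μ' ν :=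
            SimpleGraph.edist_triangle
        _ ≤ 1 + m := add_le_add (SimpleGraph.edist_eq_one_iff_adj.2 hadj).le h1
        _ = (m + 1 : ℕ) := by push_cast; rw [add_comm]
    by_cases h1 : ∃ f, h f < g f
    · exact step μ ν hh hg hpar hm h1
    by_cases h2 : ∃ f, g f < h f
    · rw [SimpleGraph.edist_comm]
      refine step ν μ hg hh (fun f => ?_) ?_ h2
      · rw [← neg_sub]; exact (hpar f).neg
      · simpa only [abs_sub_comm] using hm
    · push Not at h1 h2
      have h0 : ∀ f, g f = h f := fun f => le_antisymm (h1 f) (h2 f)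
      refine (ih μ ν hh hg hpar ?_).trans (by exact_mod_cast Nat.le_succ m)
      simp [h0]

theorem edist_le {n : ℕ} (hn : 1 ≤ n) {θ : ℝ} (hθ₀ : 0 < θ) (hθ₁ : θ < Real.pi / 2)
    (μ ν : {μ : MVAssignment n // LocallyValid θ μ}) :
    (miuraFlipGraph n θ).edist μ ν ≤ ((n ^ 2 + 1) / 2 : ℕ) := by
  obtain ⟨h, hh, hp⟩ := ((locallyValid_iff_balanced hθ₀ hθ₁).1 μ.2).exists_height
  obtain ⟨g, hg, hq⟩ := ((locallyValid_iff_balanced hθ₀ hθ₁).1 ν.2).exists_height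
  have heven (f : MiuraFace n) : Even (g f - h f) := by
    have h1 := hp f
    have h2 := hq f
    grind
  choose d hd using fun f => (heven f).two_dvd
  have hslow : IsSlow d := isSlow_of_crease fun c => by
    have h1 := hh c
    have h2 := hg c
    have h3 := hd (source c)
    have h4 := hd (target c)
    rw [abs_le]
    rcases coe_unit_eq (μ.1 c) with h | h <;> rcases coe_unit_eq (ν.1 c) with h' | h' <;> omega
  -- Shifting `g` by `-2 c` gives another height function of `ν` with the same parity.
  obtain ⟨c, hc⟩ := hslow.exists_sum_abs_le hn
  refine edist_le_of_heights hθ₀ hθ₁ _ μ ν hh (hg.add_const (-(2 * c))) (fun f => ?_) ?_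
  · have := heven f
    grind
  · have : ∑ x, |g x + -(2 * c) - h x| = 2 * ∑ x, |d x - c| := by
      rw [mul_sum]
      refine sum_congr rfl fun x _ => ?_
      rw [show g x + -(2 * c) - h x = 2 * (d x - c) by rw [mul_sub, ← hd]; ring, abs_mul]
      rfl
    rw [this]
    zify at hc ⊢
    omega

/-! ### A pair of assignments at the largest distance -/

/-- A walk moves a height function of its first vertex to one of its last vertex, by a total amount
of at most twice its length. -/
theorem exists_height_of_walk {n : ℕ} {θ : ℝ} (hθ₀ : 0 < θ) (hθ₁ : θ < Real.pi / 2)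
    {μ ν : {μ : MVAssignment n // LocallyValid θ μ}} (w : (miuraFlipGraph n θ).Walk μ ν)
    {h : MiuraFace n → ℤ} (hh : IsHeight h μ.1) :
    ∃ g, IsHeight g ν.1 ∧ ∑ x, |h x - g x| ≤ 2 * w.length := by
  induction w generalizing h with
  | nil => exact ⟨h, hh, by simp⟩
  | @cons μ μ' ν hadj w ih =>
    have hflip : ∃ f, μ'.1 = faceFlip μ.1 f := hadj
    obtain ⟨f, hf⟩ := hflip
    obtain ⟨h', hh', hs'⟩ := hh.exists_faceFlip (f := f)
      (hf ▸ (locallyValid_iff_balanced hθ₀ hθ₁).1 μ'.2)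
    obtain ⟨g, hg, hs⟩ := ih (hf ▸ hh')
    refine ⟨g, hg, ?_⟩
    have : ∑ x, |h x - g x| ≤ ∑ x, |h x - h' x| + ∑ x, |h' x - g x| := by
      rw [← sum_add_distrib]
      exact sum_le_sum fun x _ => abs_sub_le _ _ _
    rw [SimpleGraph.Walk.length_cons]
    push_cast
    linarith

theorem IsHeight.eq_add_const {n : ℕ} (hn : 1 ≤ n) {g h : MiuraFace n → ℤ} {μ : MVAssignment n}
    (hg : IsHeight g μ) (hh : IsHeight h μ) : ∃ e, ∀ f, g f = h f + e := by
  refine ⟨g (1, ⟨0, hn⟩) - h (1, ⟨0, hn⟩), fun ⟨i, j, hj⟩ => ?_⟩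
  have key : g (1, ⟨j, hj⟩) - h (1, ⟨j, hj⟩) = g (1, ⟨0, hn⟩) - h (1, ⟨0, hn⟩) := by
    induction j with
    | zero => rfl
    | succ j ih =>
      have h1 := hg (.below ⟨j, by omega⟩)
      have h2 := hh (.below ⟨j, by omega⟩)
      have h3 := ih (by omega)
      simp only [source, target] at h1 h2
      linarith
  have h1 := hg (.mid ⟨j, hj⟩)
  have h2 := hh (.mid ⟨j, hj⟩)
  simp only [source, target] at h1 h2
  fin_cases i <;> simp <;> linarith

theorem sq_le_two_mul_sum_abs (n : ℕ) :
    (n : ℤ) ^ 2 ≤ 2 * ∑ j ∈ range n, |(n : ℤ) - 2 * j| := by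
  induction n using Nat.twoStepInduction with
  | zero => simp
  | one => simp
  | more n ih _ =>
    have : ∑ j ∈ range (n + 2), |((n + 2 : ℕ) : ℤ) - 2 * j|
        = ∑ j ∈ range n, |(n : ℤ) - 2 * j| + n + (n + 2) := by
      rw [sum_range_succ', sum_range_succ]
      congr 1
      · congr 1
        · refine sum_congr rfl fun j _ => ?_
          congr 1; push_cast; ring
        · rw [abs_of_nonpos] <;> push_cast <;> linarith
    rw [this]
    push_cast
    nlinarith

/-- Pairing the upper face of column `j` with the lower face of column `n - 1 - j` eliminates the
constant `e`. -/
theorem sq_le_sum_abs_face (n : ℕ) (e : ℤ) :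
    (n : ℤ) ^ 2 ≤ ∑ x : MiuraFace n, |2 * ((x.1 : ℕ) + (x.2 : ℕ) : ℤ) - e| := by
  have hrow (a : ℤ) : ∑ j : Fin n, |2 * (a + (j : ℕ) : ℤ) - e|
      = ∑ j ∈ range n, |2 * (a + j) - e| :=
    Fin.sum_univ_eq_sum_range (fun j => |2 * (a + j) - e|) n
  rw [Fintype.sum_prod_type, Fin.sum_univ_two]
  simp only [Fin.val_zero, Fin.val_one, hrow]
  rw [← sum_range_reflect (fun j => |2 * (((1 : ℕ) : ℤ) + j) - e|), ← sum_add_distrib]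
  refine (sq_le_two_mul_sum_abs n).trans ?_
  rw [mul_sum]
  refine sum_le_sum fun j hj => ?_
  have hj' := mem_range.1 hj
  have hcast : ((n - 1 - j : ℕ) : ℤ) = n - 1 - j := by omega
  rw [hcast]
  have := abs_sub (2 * (((1 : ℕ) : ℤ) + (n - 1 - j)) - e) (2 * (((0 : ℕ) : ℤ) + j) - e)
  rw [show (2 * (((1 : ℕ) : ℤ) + (n - 1 - j)) - e) - (2 * (((0 : ℕ) : ℤ) + j) - e)
    = 2 * (n - 2 * j) by push_cast; ring, abs_mul, abs_two] at this
  linarith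

theorem exists_isHeight {n : ℕ} {h : MiuraFace n → ℤ}
    (hh : ∀ c, h (source c) - h (target c) = 1 ∨ h (source c) - h (target c) = -1) :
    ∃ μ, IsHeight h μ := by
  have (c : MiuraCrease n) : ∃ u : ℤˣ, h (source c) - h (target c) = u := by
    rcases hh c with h | h
    · exact ⟨1, by simpa using h⟩
    · exact ⟨-1, by simpa using h⟩
  choose μ hμ using this
  exact ⟨μ, hμ⟩

/-- A pair of assignments at the largest distance: those with the heights `i + j` and `-(i + j)` on
the face in row `i` and column `j`. -/
theorem exists_le_edist {n : ℕ} (hn : 1 ≤ n) {θ : ℝ} (hθ₀ : 0 < θ) (hθ₁ : θ < Real.pi / 2) :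
    ∃ μ ν, (((n ^ 2 + 1) / 2 : ℕ) : ℕ∞) ≤ (miuraFlipGraph n θ).edist μ ν := by
  let s : MiuraFace n → ℤ := fun f => (f.1 : ℕ) + (f.2 : ℕ)
  have hs (c : MiuraCrease n) : s (source c) - s (target c) = 1 ∨
      s (source c) - s (target c) = -1 := by
    cases c <;> simp [s, source, target]
  obtain ⟨μ, hμ⟩ := exists_isHeight hs
  obtain ⟨ν, hν⟩ := exists_isHeight (h := -s) fun c => by
    have := hs c
    simp only [Pi.neg_apply]
    omega
  refine ⟨⟨μ, (locallyValid_iff_balanced hθ₀ hθ₁).2 hμ.balanced⟩,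
    ⟨ν, (locallyValid_iff_balanced hθ₀ hθ₁).2 hν.balanced⟩, le_iInf fun w => ?_⟩
  obtain ⟨g, hg, hw⟩ := exists_height_of_walk hθ₀ hθ₁ w hμ
  obtain ⟨e, he⟩ := hg.eq_add_const hn hν
  have h1 := sq_le_sum_abs_face n e
  have h2 : ∑ x, |s x - g x| = ∑ x : MiuraFace n, |2 * ((x.1 : ℕ) + (x.2 : ℕ) : ℤ) - e| :=
    sum_congr rfl fun x _ => by
      rw [he x, Pi.neg_apply]
      congr 1
      simp only [s]
      ring
  rw [h2] at hw
  have h3 : n ^ 2 ≤ 2 * w.length := by exact_mod_cast h1.trans hw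
  exact_mod_cast (by omega : (n ^ 2 + 1) / 2 ≤ w.length)

theorem ceil_half_sq (n : ℕ) : ⌈(n : ℚ) ^ 2 / 2⌉₊ = (n ^ 2 + 1) / 2 := by
  apply le_antisymm
  · rw [Nat.ceil_le, div_le_iff₀ (by norm_num)]
    have : n ^ 2 ≤ (n ^ 2 + 1) / 2 * 2 := by omega
    exact_mod_cast this
  · have h := Nat.le_ceil ((n : ℚ) ^ 2 / 2)
    rw [div_le_iff₀ (by norm_num)] at h
    have : n ^ 2 ≤ ⌈(n : ℚ) ^ 2 / 2⌉₊ * 2 := by exact_mod_cast h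
    omega

end Origami

theorem mainTheorem1 (n : ℕ) (hn : 1 ≤ n) (θ : ℝ) (hθ₀ : 0 < θ) (hθ₁ : θ < Real.pi / 2) :
    (Origami.miuraFlipGraph n θ).ediam = ((⌈(n : ℚ) ^ 2 / 2⌉₊ : ℕ) : ℕ∞) := by
  rw [Origami.ceil_half_sq]
  refine le_antisymm (SimpleGraph.ediam_le_of_edist_le (Origami.edist_le hn hθ₀ hθ₁)) ?_
  obtain ⟨μ, ν, h⟩ := Origami.exists_le_edist hn hθ₀ hθ₁
  exact h.trans SimpleGraph.edist_le_ediam
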